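/- Let $m\ge 1$ be an integer, let $a_0,\dots,a_m$ and $C_0,\dots,C_{m-1}$ be real numbers with $a_m\neq 0$, and let $\alpha_1,\dots,\alpha_m$ be real numbers with $k-1<\alpha_k\le k$ for $k=1,\dots,m$. Put $$\beta_{2j}=\alpha_{j+1}-j\quad(0\le j\le m-1),\qquad \beta_{2j+1}=(j+1)-\alpha_{j+1}\quad(0\le j\le m-2),$$ and suppose that $0<\beta_k\le 1$ for all $0\le k\le 2m-2$ (that is, $\alpha_k<k$ for $k<m$). For $\alpha>0$ and the integer $n$ with $n-1<\alpha\le n$, let ${}_0^C D_t^{\alpha}$ be the Caputo derivative $${}_0^C D_t^{\alpha}f(t)=\frac1{\Gamma(n-\alpha)}\int_0^t(t-\tau)^{n-\alpha-1}f^{(n)}(\tau)\,d\tau\ \ (n-1<\alpha<n),\qquad {}_0^C D_t^{n}f(t)=f^{(n)}(t),$$ and let $AC^n[0,\infty)$ be the set of real functions that are $C^{n-1}$ on $[0,\infty)$ with $f^{(n-1)}$ absolutely continuous on $[0,T]$ for every $T>0$. Derivatives at $0$ are one-sided. Each equation below is required to hold at every $t>0$, the Caputo derivatives in it being required to exist there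 (with an absolutely convergent integral when the order is not an integer). Then, for every function $x$ on $[0,\infty)$, the following are equivalent. (i) $x\in AC^m[0,\infty)$, and $x$ solves $$a_0x(t)+\sum_{k=1}^m a_k\,{}_0^C D_t^{\alpha_k}x(t)=0,\qquad x^{(i)}(0)=C_i\quad(0\le i\le m-1).$$ (ii) There are functions $y_0,\dots,y_{2m-2}\in AC^1[0,\infty)$ that satisfy the system of $2m-1$ equations $$\begin{aligned}x(t)&=y_0(t),\\ {}_0^C D_t^{\beta_j}y_j(t)&=y_{j+1}(t),\qquad j=0,1,\dots,2m-3,\\ {}_0^C D_t^{\beta_{2m-2}}y_{2m-2}(t)&=-\frac1{a_m}\Bigl[a_0x(t)+\sum_{k=1}^{m-1}a_k\,y_{2k-1}(t)\Bigr],\end{aligned}$$ where $x=y_0$ holds on all of $[0,\infty)$, with the initial conditions $$y_{2i-1}(0)=0\quad(1\le i\le m-1),\qquad y_{2i}(0)=C_i\quad(0\le i\le m-1).$$ -/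

import Mathlib

open Set Finset MeasureTheory

noncomputable section

namespace CaputoSplit

/-- The `n`-th derivative of `f` on the half-line `[0, ∞)` (one-sided at `0`). -/
def halfLineDeriv (n : ℕ) (f : ℝ → ℝ) : ℝ → ℝ :=
  iteratedDerivWithin n f (Set.Ici 0)

/-- `f ∈ ACⁿ[0, ∞)`, for `n ≥ 1`: `f` is `C^{n-1}` on `[0, ∞)` and its derivative of order `n - 1`
is absolutely continuous on `[0, T]` for every `T > 0`.  This is the usual domain of the Caputo
derivatives of order in `(n - 1, n]`: the `n`-th derivative exists almost everywhere and is
locally integrable on `[0, ∞)`. -/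
def IsAC (n : ℕ) (f : ℝ → ℝ) : Prop :=
  ContDiffOn ℝ ((n - 1 : ℕ) : WithTop ℕ∞) f (Set.Ici 0) ∧
    ∀ T : ℝ, 0 < T → AbsolutelyContinuousOnInterval (halfLineDeriv (n - 1) f) 0 T

/-- The integrand `τ ↦ (t - τ)^{n - α - 1} f⁽ⁿ⁾(τ)` of the Caputo derivative at `t`, where
`n - 1 < α ≤ n`, that is `n = ⌈α⌉`. -/
def caputoIntegrand (α : ℝ) (f : ℝ → ℝ) (t τ : ℝ) : ℝ :=
  (t - τ) ^ ((⌈α⌉₊ : ℝ) - α - 1) * halfLineDeriv ⌈α⌉₊ f τ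

open Classical in
/-- The Caputo derivative (with base point `0`) of order `α > 0` of `f` at `t`: with `n = ⌈α⌉`, it is
`1 / Γ(n - α) ∫₀ᵗ (t - τ)^{n - α - 1} f⁽ⁿ⁾(τ) dτ` if `n - 1 < α < n`, and `f⁽ⁿ⁾(t)` if `α = n`. -/
def caputoDeriv (α : ℝ) (f : ℝ → ℝ) (t : ℝ) : ℝ :=
  if α = (⌈α⌉₊ : ℝ) then halfLineDeriv ⌈α⌉₊ f t
  else 1 / Real.Gamma ((⌈α⌉₊ : ℝ) - α) * ∫ τ in (0 : ℝ)..t, caputoIntegrand α f t τ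

open Classical in
/-- The Caputo derivative of order `α > 0` of `f` at `t` exists: the integral defining it converges
absolutely if `α` is not an integer, and `f` has an `α`-th derivative at `t` if it is. -/
def CaputoExistsAt (α : ℝ) (f : ℝ → ℝ) (t : ℝ) : Prop :=
  if α = (⌈α⌉₊ : ℝ) then
    DifferentiableWithinAt ℝ (halfLineDeriv (⌈α⌉₊ - 1) f) (Set.Ici 0) t
  else IntervalIntegrable (caputoIntegrand α f t) volume 0 t

/-- `f` has at `t` the Caputo derivative `v` of order `α`. -/
def HasCaputoDerivAt (α : ℝ) (f : ℝ → ℝ) (v : ℝ) (t : ℝ) : Prop :=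
  CaputoExistsAt α f t ∧ caputoDeriv α f t = v

/-- `x` solves on `[0, ∞)` the problem
`a₀ x + a₁ D^{α₁} x + ⋯ + a_m D^{α_m} x = 0`, `x⁽ⁱ⁾(0) = C_i` for `0 ≤ i ≤ m - 1`. -/
structure IsMultiTermSolution (m : ℕ) (a α C : ℕ → ℝ) (x : ℝ → ℝ) : Prop where
  regular : IsAC m x
  exists_caputo : ∀ k : ℕ, 1 ≤ k → k ≤ m → ∀ t : ℝ, 0 < t → CaputoExistsAt (α k) x t
  equation : ∀ t : ℝ, 0 < t →
    a 0 * x t + ∑ k ∈ Finset.Icc 1 m, a k * caputoDeriv (α k) x t = 0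
  initial : ∀ i : ℕ, i < m → halfLineDeriv i x 0 = C i

/-- The orders `β_{2j} = α_{j+1} - j` and `β_{2j+1} = (j + 1) - α_{j+1}`. -/
def splitOrder (α : ℕ → ℝ) (k : ℕ) : ℝ :=
  if k % 2 = 0 then α (k / 2 + 1) - ((k / 2 : ℕ) : ℝ)
  else ((k / 2 + 1 : ℕ) : ℝ) - α (k / 2 + 1)

/-- `x = y₀` and `y₀, …, y_{2m-2}` solve on `[0, ∞)` the system of `2m - 1` equations
`D^{β_j} y_j = y_{j+1}` for `0 ≤ j ≤ 2m - 3` and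
`D^{β_{2m-2}} y_{2m-2} = -(1/a_m) (a₀ x + a₁ y₁ + a₂ y₃ + ⋯ + a_{m-1} y_{2m-3})`,
with `y_{2i-1}(0) = 0` for `1 ≤ i ≤ m - 1` and `y_{2i}(0) = C_i` for `0 ≤ i ≤ m - 1`.
Only the members `y 0, …, y (2 * m - 2)` of the family `y` occur. -/
structure IsSystemSolution (m : ℕ) (a β C : ℕ → ℝ) (x : ℝ → ℝ) (y : ℕ → ℝ → ℝ) : Prop where
  regular : ∀ j : ℕ, j ≤ 2 * m - 2 → IsAC 1 (y j)
  first : ∀ t : ℝ, 0 ≤ t → x t = y 0 t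
  chain : ∀ j : ℕ, j < 2 * m - 2 → ∀ t : ℝ, 0 < t →
    HasCaputoDerivAt (β j) (y j) (y (j + 1) t) t
  last : ∀ t : ℝ, 0 < t →
    HasCaputoDerivAt (β (2 * m - 2)) (y (2 * m - 2))
      (-1 / a m * (a 0 * x t + ∑ k ∈ Finset.Icc 1 (m - 1), a k * y (2 * k - 1) t)) t
  initial_odd : ∀ i : ℕ, 1 ≤ i → i < m → y (2 * i - 1) 0 = 0
  initial_even : ∀ i : ℕ, i < m → y (2 * i) 0 = C i

end CaputoSplit

end

/-!
Write `I^a` for the Riemann–Liouville integral of order `a` based at `0` (`rlInt`). A Caputo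
derivative of non-integer order `α < n` is `I^(n - α)` applied to the `n`-th derivative, and it
depends on `f` only through the derivative of order `n - 1`: it is the Caputo derivative of order
`α - (n - 1)` of `f⁽ⁿ⁻¹⁾` (`hasCaputoDerivAt_iff_sub`). So everything rests on the passage from
`x⁽ʲ⁾` to `x⁽ʲ⁺¹⁾` through two complementary orders `β` and `1 - β`, and on the semigroup law
`I^a I^b = I^(a + b)` (`rlInt_rlInt`), which follows from Fubini's theorem and the beta integral. For
`1 ≤ a + b` the law holds at every point, with absolute convergence, for every locally integrable
function.

From the scalar equation to the system, the family is `y_{2j} = x⁽ʲ⁾` and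
`y_{2j+1} = I^(1-β) x⁽ʲ⁺¹⁾`, with `β = β_{2j} < 1`. For `g = x⁽ʲ⁺¹⁾` absolutely continuous,
`I^(1-β) g` is absolutely continuous with derivative `g(0) t^(-β) / Γ(1-β) + I^(1-β) g'` almost
everywhere, and `I^β` sends the latter to `g(0) + ∫ g' = g` (`isAC_rlInt`).

From the system to the scalar equation, `y_{2j+1} = I^(1-β) y_{2j}'` and `y_{2j+2} = I^β y_{2j+1}'`
with `y_{2j+1}(0) = 0` give `∫ y_{2j+2} = I^β y_{2j+1} = ∫ y_{2j}'`. As `y_{2j+2}` is continuous,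
`y_{2j}` is continuously differentiable on the half-line with derivative `y_{2j+2}`
(`hasDerivWithinAt_of_chain`), whence `y_{2j} = x⁽ʲ⁾` for all `j < m`.
-/

namespace CaputoSplit

/-! ### Fractional integrals -/

/-- The Riemann–Liouville fractional integral of order `a > 0` with base point `0`. Its value at
`t = 0` is `0`. -/
noncomputable def rlInt (a : ℝ) (φ : ℝ → ℝ) (t : ℝ) : ℝ :=
  1 / Real.Gamma a * ∫ τ in (0 : ℝ)..t, (t - τ) ^ (a - 1) * φ τ

theorem rlInt_zero (a : ℝ) (φ : ℝ → ℝ) : rlInt a φ 0 = 0 := by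
  simp [rlInt]

theorem rlInt_one (φ : ℝ → ℝ) (t : ℝ) : rlInt 1 φ t = ∫ τ in (0 : ℝ)..t, φ τ := by
  simp [rlInt]

theorem rlInt_congr_ae {a t : ℝ} {φ ψ : ℝ → ℝ} (ht : 0 ≤ t)
    (h : ∀ᵐ τ, 0 < τ → φ τ = ψ τ) : rlInt a φ t = rlInt a ψ t := by
  unfold rlInt
  congr 1
  apply intervalIntegral.integral_congr_ae
  filter_upwards [h] with τ hτ hmem
  rw [uIoc_of_le ht] at hmem
  rw [hτ hmem.1]

theorem rlInt_congr {a t : ℝ} {φ ψ : ℝ → ℝ} (ht : 0 ≤ t)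
    (h : ∀ τ, 0 < τ → φ τ = ψ τ) : rlInt a φ t = rlInt a ψ t :=
  rlInt_congr_ae ht (Filter.Eventually.of_forall h)

theorem intervalIntegrable_rpow_mul_rpow {a b : ℝ} (ha : 0 < a) (hb : 0 < b) {s t : ℝ}
    (hst : s < t) :
    IntervalIntegrable (fun τ => (t - τ) ^ (a - 1) * (τ - s) ^ (b - 1)) volume s t := by
  -- Each half of the interval contains a single singularity.
  set c := (s + t) / 2 with hc
  have h1 : s < c := by linarith
  have h2 : c < t := by linarith
  have hl : IntervalIntegrable (fun τ => (τ - s) ^ (b - 1)) volume s c := by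
    have := (intervalIntegral.intervalIntegrable_rpow' (a := 0) (b := c - s)
      (r := b - 1) (by linarith)).comp_sub_right s
    simpa using this
  have hr : IntervalIntegrable (fun τ => (t - τ) ^ (a - 1)) volume c t := by
    have := (intervalIntegral.intervalIntegrable_rpow' (a := t - c) (b := 0)
      (r := a - 1) (by linarith)).comp_sub_left t
    simpa using this
  refine IntervalIntegrable.trans (b := c) ?_ ?_
  · refine hl.continuousOn_mul ?_
    rw [uIcc_of_le h1.le]
    exact ContinuousOn.rpow_const (by fun_prop) fun τ hτ => Or.inl (by
      have := hτ.2; intro h; linarith)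
  · refine hr.mul_continuousOn ?_
    rw [uIcc_of_le h2.le]
    exact ContinuousOn.rpow_const (by fun_prop) fun τ hτ => Or.inl (by
      have := hτ.1; intro h; linarith)

/-- The beta integral on an arbitrary interval. -/
theorem integral_rpow_mul_rpow {a b : ℝ} (ha : 0 < a) (hb : 0 < b) {s t : ℝ} (hst : s < t) :
    ∫ τ in s..t, (t - τ) ^ (a - 1) * (τ - s) ^ (b - 1)
      = Real.Gamma a * Real.Gamma b / Real.Gamma (a + b) * (t - s) ^ (a + b - 1) := by
  have hu : 0 < t - s := sub_pos.2 hst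
  have h0 : ∫ τ in s..t, (t - τ) ^ (a - 1) * (τ - s) ^ (b - 1)
      = ∫ u in (0 : ℝ)..(t - s), u ^ (b - 1) * ((t - s) - u) ^ (a - 1) := by
    have := intervalIntegral.integral_comp_sub_right (a := s) (b := t)
      (fun u => u ^ (b - 1) * ((t - s) - u) ^ (a - 1)) s
    rw [sub_self] at this
    rw [← this]
    refine intervalIntegral.integral_congr fun τ _ => ?_
    rw [mul_comm]
    congr 2
    ring
  rw [h0]
  have h1 := Complex.betaIntegral_scaled (b : ℂ) (a : ℂ) hu
  rw [Complex.betaIntegral_eq_Gamma_mul_div _ _ (by simpa using hb) (by simpa using ha)] at h1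
  have h2 : ∫ u in (0 : ℝ)..(t - s), (u : ℂ) ^ ((b : ℂ) - 1) * (((t - s : ℝ) : ℂ) - u) ^ ((a : ℂ) - 1)
      = ((∫ u in (0 : ℝ)..(t - s), u ^ (b - 1) * ((t - s) - u) ^ (a - 1) : ℝ) : ℂ) := by
    rw [← intervalIntegral.integral_ofReal]
    refine intervalIntegral.integral_congr fun u hmem => ?_
    rw [uIcc_of_le hu.le] at hmem
    rw [Complex.ofReal_mul, Complex.ofReal_cpow hmem.1, Complex.ofReal_cpow (sub_nonneg.2 hmem.2)]
    push_cast
    rfl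
  rw [h2] at h1
  apply Complex.ofReal_injective
  rw [h1]
  push_cast [Complex.ofReal_cpow hu.le, Complex.Gamma_ofReal]
  rw [← Complex.Gamma_ofReal, ← Complex.Gamma_ofReal, ← Complex.Gamma_ofReal]
  push_cast
  rw [add_comm (b : ℂ) a]
  ring

theorem intervalIntegrable_kernel_mul_rpow {a b : ℝ} (ha : 0 < a) (hb : 0 < b) {t : ℝ}
    (ht : 0 < t) :
    IntervalIntegrable (fun τ => (t - τ) ^ (a - 1) * (τ ^ (b - 1) / Real.Gamma b)) volume 0 t := by
  have := (intervalIntegrable_rpow_mul_rpow ha hb ht).div_const (Real.Gamma b)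
  simpa [mul_div_assoc] using this

/-- The fractional integral of the kernel of order `b` is the kernel of order `a + b`. -/
theorem rlInt_rpow {a b : ℝ} (ha : 0 < a) (hb : 0 < b) {t : ℝ} (ht : 0 < t) :
    rlInt a (fun τ => τ ^ (b - 1) / Real.Gamma b) t = t ^ (a + b - 1) / Real.Gamma (a + b) := by
  have h := integral_rpow_mul_rpow ha hb ht
  have hA := (Real.Gamma_pos_of_pos ha).ne'
  have hB := (Real.Gamma_pos_of_pos hb).ne'
  unfold rlInt
  simp only [sub_zero] at h
  simp_rw [← mul_div_assoc]
  rw [intervalIntegral.integral_div, h]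
  field_simp

/-- The integrand `(t - τ) ^ (a - 1) * (τ - s) ^ (b - 1) * φ s` of the iterated fractional integral
as a function of `(τ, s)`, extended by `0` outside `s < τ`; the Gamma factors are left out. -/
noncomputable def iteratedKernel (a b t : ℝ) (φ : ℝ → ℝ) (p : ℝ × ℝ) : ℝ :=
  (Set.Ioi p.2).indicator (fun τ => (t - τ) ^ (a - 1) * (τ - p.2) ^ (b - 1)) p.1 * φ p.2

theorem integral_indicator_kernel {a b : ℝ} (ha : 0 < a) (hb : 0 < b) {s t : ℝ}
    (hs : s ∈ Set.Ioo 0 t) :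
    Integrable ((Set.Ioi s).indicator fun τ => (t - τ) ^ (a - 1) * (τ - s) ^ (b - 1))
      (volume.restrict (Set.Ioo 0 t)) ∧
    ∫ τ in Set.Ioo 0 t, (Set.Ioi s).indicator (fun τ => (t - τ) ^ (a - 1) * (τ - s) ^ (b - 1)) τ
      = Real.Gamma a * Real.Gamma b / Real.Gamma (a + b) * (t - s) ^ (a + b - 1) := by
  have hset : Set.Ioi s ∩ Set.Ioo 0 t = Set.Ioo s t := by
    ext τ
    simp only [Set.mem_inter_iff, Set.mem_Ioi, Set.mem_Ioo]
    have := hs.1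
    constructor
    · rintro ⟨h1, h2, h3⟩; exact ⟨h1, h3⟩
    · rintro ⟨h1, h2⟩; exact ⟨h1, by linarith, h2⟩
  constructor
  · rw [integrable_indicator_iff measurableSet_Ioi, IntegrableOn,
      Measure.restrict_restrict measurableSet_Ioi, hset]
    have := intervalIntegrable_rpow_mul_rpow ha hb hs.2
    rwa [intervalIntegrable_iff_integrableOn_Ioo_of_le hs.2.le] at this
  · rw [integral_indicator measurableSet_Ioi, Measure.restrict_restrict measurableSet_Ioi, hset,
      ← integral_Ioc_eq_integral_Ioo, ← intervalIntegral.integral_of_le hs.2.le,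
      integral_rpow_mul_rpow ha hb hs.2]

/-- Tonelli's theorem reduces this to the beta integral; `1 ≤ a + b` keeps the factor
`(t - s) ^ (a + b - 1)` bounded, so that no growth condition on `φ` is needed. -/
theorem integrable_iteratedKernel {a b : ℝ} (ha : 0 < a) (hb : 0 < b) (hab : 1 ≤ a + b) {t : ℝ}
    (ht : 0 < t) {φ : ℝ → ℝ} (hφ : IntervalIntegrable φ volume 0 t) :
    Integrable (iteratedKernel a b t φ)
      ((volume.restrict (Set.Ioo 0 t)).prod (volume.restrict (Set.Ioo 0 t))) := by
  rw [intervalIntegrable_iff_integrableOn_Ioo_of_le ht.le] at hφ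
  have hmeas : AEStronglyMeasurable (iteratedKernel a b t φ)
      ((volume.restrict (Set.Ioo 0 t)).prod (volume.restrict (Set.Ioo 0 t))) := by
    refine AEStronglyMeasurable.mul ?_ hφ.aestronglyMeasurable.comp_snd
    have heq : (fun p : ℝ × ℝ => (Set.Ioi p.2).indicator
        (fun τ => (t - τ) ^ (a - 1) * (τ - p.2) ^ (b - 1)) p.1)
        = {p : ℝ × ℝ | p.2 < p.1}.indicator
          (fun p => (t - p.1) ^ (a - 1) * (p.1 - p.2) ^ (b - 1)) := by
      ext p
      simp [Set.indicator_apply]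
    rw [heq]
    refine Measurable.aestronglyMeasurable (Measurable.indicator ?_ ?_)
    · fun_prop
    · exact measurableSet_lt measurable_snd measurable_fst
  rw [integrable_prod_iff' hmeas]
  constructor
  · refine (ae_restrict_iff' measurableSet_Ioo).2 (Filter.Eventually.of_forall fun s hs => ?_)
    exact (integral_indicator_kernel ha hb hs).1.mul_const (φ s)
  · have hint : Integrable (fun s => ‖φ s‖ * (Real.Gamma a * Real.Gamma b / Real.Gamma (a + b) *
        (t - s) ^ (a + b - 1))) (volume.restrict (Set.Ioo 0 t)) := by
      have hmul := IntegrableOn.mul_continuousOn_of_subset (K := Set.Icc 0 t)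
        (g' := fun s => Real.Gamma a * Real.Gamma b / Real.Gamma (a + b) *
          (t - s) ^ (a + b - 1)) (Integrable.norm hφ) ?_ measurableSet_Ioo isCompact_Icc
          Set.Ioo_subset_Icc_self
      · exact hmul
      · refine ContinuousOn.mul continuousOn_const
          (ContinuousOn.rpow_const (by fun_prop) fun _ _ => Or.inr (by linarith))
    refine hint.congr ?_
    refine (ae_restrict_iff' measurableSet_Ioo).2 (Filter.Eventually.of_forall fun s hs => ?_)
    simp only
    rw [← (integral_indicator_kernel ha hb hs).2, mul_comm, ← integral_mul_const]
    refine setIntegral_congr_fun measurableSet_Ioo fun τ hτ => ?_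
    simp only [iteratedKernel, norm_mul]
    congr 1
    rw [Real.norm_of_nonneg]
    refine Set.indicator_apply_nonneg fun hsτ => ?_
    exact mul_nonneg (Real.rpow_nonneg (sub_nonneg.2 hτ.2.le) _)
      (Real.rpow_nonneg (sub_nonneg.2 (le_of_lt hsτ)) _)

theorem setIntegral_iteratedKernel_right {a b t : ℝ} {φ : ℝ → ℝ} (hb : 0 < b) {τ : ℝ}
    (hτ : τ ∈ Set.Ioo 0 t) :
    ∫ s in Set.Ioo 0 t, iteratedKernel a b t φ (τ, s)
      = Real.Gamma b * ((t - τ) ^ (a - 1) * rlInt b φ τ) := by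
  have hset : Set.Iio τ ∩ Set.Ioo 0 t = Set.Ioo 0 τ := by
    ext s
    simp only [Set.mem_inter_iff, Set.mem_Iio, Set.mem_Ioo]
    have := hτ.2
    constructor
    · rintro ⟨h1, h2, h3⟩; exact ⟨h2, h1⟩
    · rintro ⟨h1, h2⟩; exact ⟨h2, h1, by linarith⟩
  have heq : (fun s => iteratedKernel a b t φ (τ, s))
      = (Set.Iio τ).indicator fun s => (t - τ) ^ (a - 1) * ((τ - s) ^ (b - 1) * φ s) := by
    ext s
    by_cases h : s < τ
    · simp [iteratedKernel, h, mul_assoc]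
    · simp [iteratedKernel, h]
  have hB := (Real.Gamma_pos_of_pos hb).ne'
  rw [heq, integral_indicator measurableSet_Iio, Measure.restrict_restrict measurableSet_Iio, hset,
    ← integral_Ioc_eq_integral_Ioo, ← intervalIntegral.integral_of_le hτ.1.le,
    intervalIntegral.integral_const_mul, rlInt]
  field_simp

theorem intervalIntegrable_kernel_mul_rlInt {a b : ℝ} (ha : 0 < a) (hb : 0 < b)
    (hab : 1 ≤ a + b) {t : ℝ} (ht : 0 < t) {φ : ℝ → ℝ} (hφ : IntervalIntegrable φ volume 0 t) :
    IntervalIntegrable (fun τ => (t - τ) ^ (a - 1) * rlInt b φ τ) volume 0 t := by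
  have hB := (Real.Gamma_pos_of_pos hb).ne'
  rw [intervalIntegrable_iff_integrableOn_Ioo_of_le ht.le]
  refine ((integrable_iteratedKernel ha hb hab ht hφ).integral_prod_left.const_mul
    (1 / Real.Gamma b)).congr ?_
  refine (ae_restrict_iff' measurableSet_Ioo).2 (Filter.Eventually.of_forall fun τ hτ => ?_)
  simp only
  rw [setIntegral_iteratedKernel_right hb hτ]
  field_simp

theorem intervalIntegrable_rlInt {b : ℝ} (hb : 0 < b) {t : ℝ} (ht : 0 < t) {φ : ℝ → ℝ}
    (hφ : IntervalIntegrable φ volume 0 t) : IntervalIntegrable (rlInt b φ) volume 0 t := by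
  simpa using intervalIntegrable_kernel_mul_rlInt one_pos hb (by linarith) ht hφ

/-- The semigroup law of fractional integration. For `1 ≤ a + b` it holds at every point, and not
only almost everywhere. -/
theorem rlInt_rlInt {a b : ℝ} (ha : 0 < a) (hb : 0 < b) (hab : 1 ≤ a + b) {t : ℝ} (ht : 0 < t)
    {φ : ℝ → ℝ} (hφ : IntervalIntegrable φ volume 0 t) :
    rlInt a (rlInt b φ) t = rlInt (a + b) φ t := by
  have hA := (Real.Gamma_pos_of_pos ha).ne'
  have hB := (Real.Gamma_pos_of_pos hb).ne'
  have hAB := (Real.Gamma_pos_of_pos (add_pos ha hb)).ne'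
  have hswap := integral_integral_swap (f := fun τ s => iteratedKernel a b t φ (τ, s))
    (integrable_iteratedKernel ha hb hab ht hφ)
  have hr : ∫ s in Set.Ioo 0 t, ∫ τ in Set.Ioo 0 t, iteratedKernel a b t φ (τ, s)
      = ∫ s in Set.Ioo 0 t, Real.Gamma a * Real.Gamma b / Real.Gamma (a + b) *
        ((t - s) ^ (a + b - 1) * φ s) := by
    refine setIntegral_congr_fun measurableSet_Ioo fun s hs => ?_
    simp only [iteratedKernel]
    rw [integral_mul_const, (integral_indicator_kernel ha hb hs).2]
    ring
  rw [hr, setIntegral_congr_fun measurableSet_Ioo fun τ hτ =>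
      setIntegral_iteratedKernel_right hb hτ, integral_const_mul, integral_const_mul,
    ← integral_Ioc_eq_integral_Ioo, ← integral_Ioc_eq_integral_Ioo,
    ← intervalIntegral.integral_of_le ht.le, ← intervalIntegral.integral_of_le ht.le] at hswap
  have hdiv : ∫ τ in (0 : ℝ)..t, (t - τ) ^ (a - 1) * rlInt b φ τ
      = Real.Gamma a / Real.Gamma (a + b) * ∫ s in (0 : ℝ)..t, (t - s) ^ (a + b - 1) * φ s := by
    apply mul_left_cancel₀ hB
    rw [hswap]
    ring
  rw [rlInt, hdiv, rlInt]
  field_simp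

/-! ### Absolutely continuous functions on the half-line -/

theorem halfLineDeriv_zero (f : ℝ → ℝ) : halfLineDeriv 0 f = f :=
  iteratedDerivWithin_zero

theorem halfLineDeriv_succ (n : ℕ) (f : ℝ → ℝ) :
    halfLineDeriv (n + 1) f = derivWithin (halfLineDeriv n f) (Set.Ici 0) :=
  iteratedDerivWithin_succ

theorem halfLineDeriv_one (f : ℝ → ℝ) : halfLineDeriv 1 f = derivWithin f (Set.Ici 0) := by
  rw [halfLineDeriv_succ, halfLineDeriv_zero]

theorem derivWithin_eqOn {f g : ℝ → ℝ} (h : Set.EqOn f g (Set.Ici 0)) :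
    Set.EqOn (derivWithin f (Set.Ici 0)) (derivWithin g (Set.Ici 0)) (Set.Ici 0) :=
  fun _ ht => derivWithin_congr h (h ht)

/-- Absolute continuity on an interval depends only on the values there. -/
theorem absolutelyContinuousOnInterval_congr {f g : ℝ → ℝ} {a b : ℝ}
    (hf : AbsolutelyContinuousOnInterval f a b) (h : Set.EqOn f g (Set.uIcc a b)) :
    AbsolutelyContinuousOnInterval g a b := by
  rw [absolutelyContinuousOnInterval_iff] at hf ⊢
  intro ε hε
  obtain ⟨δ, hδ, H⟩ := hf ε hε
  refine ⟨δ, hδ, fun E hE hlt => ?_⟩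
  rw [Finset.sum_congr rfl fun i hi => by
    rw [← h (hE.1 i hi).1, ← h (hE.1 i hi).2]]
  exact H E hE hlt

theorem isAC_one_iff {f : ℝ → ℝ} :
    IsAC 1 f ↔ ∀ T : ℝ, 0 < T → AbsolutelyContinuousOnInterval f 0 T := by
  unfold IsAC
  simp only [Nat.sub_self, halfLineDeriv_zero, Nat.cast_zero, contDiffOn_zero, and_iff_right_iff_imp]
  intro h t ht
  have ht0 : (0 : ℝ) ≤ t := ht
  have hc := (h (t + 1) (by linarith)).continuousOn t (by
    rw [Set.uIcc_of_le (by linarith)]; exact ⟨ht0, by linarith⟩)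
  rw [Set.uIcc_of_le (by linarith)] at hc
  refine hc.mono_of_mem_nhdsWithin ?_
  rw [← Set.Ici_inter_Iic]
  exact inter_mem_nhdsWithin _ (Iic_mem_nhds (by linarith))

theorem IsAC.congr_one {f g : ℝ → ℝ} (hf : IsAC 1 f) (h : Set.EqOn f g (Set.Ici 0)) :
    IsAC 1 g := by
  rw [isAC_one_iff] at hf ⊢
  intro T hT
  refine absolutelyContinuousOnInterval_congr (hf T hT) (h.mono ?_)
  rw [Set.uIcc_of_le hT.le]
  exact Set.Icc_subset_Ici_self

theorem IsAC.continuousOn_one {f : ℝ → ℝ} (hf : IsAC 1 f) : ContinuousOn f (Set.Ici 0) := by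
  simpa [IsAC] using hf.1

theorem isAC_one_of_contDiffOn {f : ℝ → ℝ} (hf : ContDiffOn ℝ 1 f (Set.Ici 0)) : IsAC 1 f := by
  rw [isAC_one_iff]
  intro T hT
  refine (hf.mono ?_).absolutelyContinuousOnInterval
  rw [Set.uIcc_of_le hT.le]
  exact Set.Icc_subset_Ici_self

theorem ae_deriv_eq_halfLineDeriv (f : ℝ → ℝ) (T : ℝ) :
    ∀ᵐ t : ℝ, t ∈ Set.Ioc 0 T → deriv f t = halfLineDeriv 1 f t := by
  refine Filter.Eventually.of_forall fun t ht => ?_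
  rw [halfLineDeriv_one, derivWithin_of_mem_nhds (Ici_mem_nhds ht.1)]

theorem IsAC.intervalIntegrable_deriv_one {f : ℝ → ℝ} (hf : IsAC 1 f) {t : ℝ} (ht : 0 < t) :
    IntervalIntegrable (halfLineDeriv 1 f) volume 0 t := by
  refine (isAC_one_iff.1 hf t ht).intervalIntegrable_deriv.congr_ae ?_
  rw [uIoc_of_le ht.le, Filter.EventuallyEq, ae_restrict_iff' measurableSet_Ioc]
  exact ae_deriv_eq_halfLineDeriv f t

theorem IsAC.eq_add_rlInt {f : ℝ → ℝ} (hf : IsAC 1 f) {t : ℝ} (ht : 0 ≤ t) :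
    f t = f 0 + rlInt 1 (halfLineDeriv 1 f) t := by
  rcases ht.eq_or_lt with rfl | ht
  · simp [rlInt_zero]
  have h := (isAC_one_iff.1 hf t ht).integral_deriv_eq_sub
  rw [rlInt_one, ← intervalIntegral.integral_congr_ae
    (by simpa [uIoc_of_le ht.le] using ae_deriv_eq_halfLineDeriv f t), h]
  ring

/-- The Lebesgue differentiation theorem on the half-line. -/
theorem isAC_one_of_eq_add_rlInt {f φ : ℝ → ℝ}
    (hφ : ∀ T, 0 < T → IntervalIntegrable φ volume 0 T)
    (h : ∀ t, 0 ≤ t → f t = f 0 + rlInt 1 φ t) :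
    IsAC 1 f ∧ ∀ᵐ t, 0 < t → halfLineDeriv 1 f t = φ t := by
  constructor
  · have hconst : IsAC 1 fun _ : ℝ => f 0 := isAC_one_of_contDiffOn contDiffOn_const
    rw [isAC_one_iff] at hconst ⊢
    intro T hT
    refine absolutelyContinuousOnInterval_congr ((hconst T hT).add
      ((hφ T hT).absolutelyContinuousOnInterval_intervalIntegral
        (Set.left_mem_uIcc : (0 : ℝ) ∈ Set.uIcc 0 T))) fun t ht => ?_
    rw [Set.uIcc_of_le hT.le] at ht
    rw [h t ht.1, rlInt_one]
    rfl
  · have hall : ∀ n : ℕ, ∀ᵐ t : ℝ, t ∈ Set.uIcc 0 ((n : ℝ) + 1) →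
        HasDerivAt (fun u => ∫ v in (0 : ℝ)..u, φ v) (φ t) t := fun n => by
      filter_upwards [(hφ ((n : ℝ) + 1) (by positivity)).ae_hasDerivAt_integral] with t ht hmem
      exact ht hmem 0 Set.left_mem_uIcc
    filter_upwards [ae_all_iff.2 hall] with t ht hpos
    obtain ⟨n, hn⟩ := exists_nat_gt t
    have hd := ht n (by rw [Set.uIcc_of_le (by positivity)]; exact ⟨hpos.le, by linarith⟩)
    rw [halfLineDeriv_one, derivWithin_of_mem_nhds (Ici_mem_nhds hpos)]
    refine HasDerivAt.deriv ((hd.const_add (f 0)).congr_of_eventuallyEq ?_)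
    filter_upwards [Ioi_mem_nhds hpos] with u hu
    rw [h u (le_of_lt hu), rlInt_one]

/-- The fundamental theorem of calculus on the half-line, including the endpoint `0`. -/
theorem hasDerivWithinAt_of_eq_add_rlInt {f g : ℝ → ℝ} (hg : ContinuousOn g (Set.Ici 0))
    (h : ∀ t, 0 ≤ t → f t = f 0 + rlInt 1 g t) {t : ℝ} (ht : 0 ≤ t) :
    HasDerivWithinAt f (g t) (Set.Ici 0) t := by
  -- The even extension of `g` is continuous on the whole line.
  have hc : Continuous fun u : ℝ => g |u| :=
    hg.comp_continuous continuous_abs fun u => abs_nonneg u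
  have hd : HasDerivAt (fun u => ∫ v in (0 : ℝ)..u, g |v|) (g |t|) t :=
    intervalIntegral.integral_hasDerivAt_right (hc.intervalIntegrable _ _)
      (hc.stronglyMeasurableAtFilter _ _) hc.continuousAt
  rw [abs_of_nonneg ht] at hd
  have key : ∀ u ∈ Set.Ici (0 : ℝ), f u = f 0 + ∫ v in (0 : ℝ)..u, g |v| := fun u hu => by
    rw [h u hu, rlInt_one]
    congr 1
    refine intervalIntegral.integral_congr fun v hv => ?_
    rw [Set.uIcc_of_le hu] at hv
    simp only [abs_of_nonneg hv.1]
  exact ((hd.const_add (f 0)).hasDerivWithinAt).congr key (key t ht)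

/-! ### Splitting an integer derivative into two fractional ones -/

/-- For an absolutely continuous `g` the fractional integral `y = I^b g` is again absolutely
continuous, with derivative `g 0 * t ^ (b - 1) / Γ b + I^b g'` almost everywhere. Applying
`I^(1 - b)` to this derivative returns `g 0 + ∫ g' = g`. -/
theorem isAC_rlInt {b : ℝ} (hb0 : 0 < b) (hb1 : b < 1) {g : ℝ → ℝ} (hg : IsAC 1 g) :
    IsAC 1 (rlInt b g) ∧ ∀ t, 0 < t →
      IntervalIntegrable (fun τ => (t - τ) ^ ((1 - b) - 1) * halfLineDeriv 1 (rlInt b g) τ)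
        volume 0 t ∧
      rlInt (1 - b) (halfLineDeriv 1 (rlInt b g)) t = g t := by
  set φ := halfLineDeriv 1 g with hφdef
  have hφ : ∀ T, 0 < T → IntervalIntegrable φ volume 0 T := fun T hT =>
    hg.intervalIntegrable_deriv_one hT
  set p : ℝ → ℝ := fun τ => τ ^ (b - 1) / Real.Gamma b with hp
  set h : ℝ → ℝ := fun τ => g 0 * p τ + rlInt b φ τ with hh
  have hpint : ∀ T, 0 < T → IntervalIntegrable p volume 0 T := fun T hT => by
    simpa using intervalIntegrable_kernel_mul_rpow one_pos hb0 hT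
  have hhint : ∀ T, 0 < T → IntervalIntegrable h volume 0 T := fun T hT =>
    ((hpint T hT).const_mul (g 0)).add (intervalIntegrable_rlInt hb0 hT (hφ T hT))
  have hlin : ∀ {a : ℝ} {u v : ℝ → ℝ} {t : ℝ},
      IntervalIntegrable (fun τ => (t - τ) ^ (a - 1) * u τ) volume 0 t →
      IntervalIntegrable (fun τ => (t - τ) ^ (a - 1) * v τ) volume 0 t →
      rlInt a (fun τ => g 0 * u τ + v τ) t = g 0 * rlInt a u t + rlInt a v t := by
    intro a u v t hu hv
    unfold rlInt
    have hs : (fun τ => (t - τ) ^ (a - 1) * (g 0 * u τ + v τ))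
        = fun τ => g 0 * ((t - τ) ^ (a - 1) * u τ) + (t - τ) ^ (a - 1) * v τ := by
      ext τ; ring
    rw [hs, intervalIntegral.integral_add (hu.const_mul _) hv, intervalIntegral.integral_const_mul]
    ring
  have hone : (fun τ : ℝ => τ ^ ((1 : ℝ) - 1) / Real.Gamma 1) = fun _ => (1 : ℝ) := by
    ext τ; simp
  have hy : ∀ t, 0 ≤ t → rlInt b g t = rlInt b g 0 + rlInt 1 h t := by
    intro t ht
    rcases ht.eq_or_lt with rfl | ht
    · simp [rlInt_zero]
    have e1 : rlInt b g t = rlInt b (fun τ => g 0 * (1 : ℝ) + rlInt 1 φ τ) t :=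
      rlInt_congr ht.le fun τ hτ => by rw [hg.eq_add_rlInt hτ.le, mul_one]
    have k1 := intervalIntegrable_kernel_mul_rpow hb0 one_pos ht
    have k2 := rlInt_rpow hb0 one_pos ht
    rw [hone] at k2
    simp only [sub_self, Real.rpow_zero, Real.Gamma_one, div_one] at k1
    rw [e1, hlin k1 (intervalIntegrable_kernel_mul_rlInt hb0 one_pos (by linarith) ht (hφ t ht)),
      k2, rlInt_rlInt hb0 one_pos (by linarith) ht (hφ t ht), rlInt_zero, zero_add, hh,
      hlin (intervalIntegrable_kernel_mul_rpow one_pos hb0 ht)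
        (intervalIntegrable_kernel_mul_rlInt one_pos hb0 (by linarith) ht (hφ t ht)),
      rlInt_rpow one_pos hb0 ht, rlInt_rlInt one_pos hb0 (by linarith) ht (hφ t ht),
      add_comm b 1]
  obtain ⟨hac, hae⟩ := isAC_one_of_eq_add_rlInt hhint hy
  refine ⟨hac, fun t ht => ?_⟩
  have hb' : 0 < 1 - b := by linarith
  have i1 := intervalIntegrable_kernel_mul_rpow hb' hb0 ht
  have i2 := intervalIntegrable_kernel_mul_rlInt hb' hb0 (by linarith) ht (hφ t ht)
  constructor
  · refine ((i1.const_mul (g 0)).add i2).congr_ae ?_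
    rw [uIoc_of_le ht.le, Filter.EventuallyEq, ae_restrict_iff' measurableSet_Ioc]
    filter_upwards [hae] with τ hτ hmem
    rw [hτ hmem.1]
    simp only [hh, hp]
    ring
  · rw [rlInt_congr_ae ht.le hae, hh, hlin i1 i2, rlInt_rpow hb' hb0 ht,
      rlInt_rlInt hb' hb0 (by linarith) ht (hφ t ht), sub_add_cancel, hg.eq_add_rlInt ht.le]
    simp [hφdef]

/-- If `y₁ = I^b y₀'` is absolutely continuous with `y₁ 0 = 0` and `y₂ = I^(1 - b) y₁'`, then
`∫ y₂ = I^(1 - b) y₁ = ∫ y₀'`, whence `y₀' = y₂`. -/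
theorem hasDerivWithinAt_of_chain {b : ℝ} (hb0 : 0 < b) (hb1 : b < 1) {y₀ y₁ y₂ : ℝ → ℝ}
    (h₀ : IsAC 1 y₀) (h₁ : IsAC 1 y₁) (h₂ : IsAC 1 y₂) (hzero : y₁ 0 = 0)
    (e₁ : ∀ t, 0 < t → rlInt b (halfLineDeriv 1 y₀) t = y₁ t)
    (e₂ : ∀ t, 0 < t → rlInt (1 - b) (halfLineDeriv 1 y₁) t = y₂ t) {t : ℝ} (ht : 0 ≤ t) :
    HasDerivWithinAt y₀ (y₂ t) (Set.Ici 0) t := by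
  refine hasDerivWithinAt_of_eq_add_rlInt h₂.continuousOn_one (fun u hu => ?_) ht
  rcases hu.eq_or_lt with rfl | hu
  · simp [rlInt_zero]
  have hb' : 0 < 1 - b := by linarith
  have i₀ := h₀.intervalIntegrable_deriv_one hu
  have i₁ := h₁.intervalIntegrable_deriv_one hu
  rw [h₀.eq_add_rlInt hu.le, ← rlInt_congr hu.le e₂, rlInt_rlInt one_pos hb' (by linarith) hu i₁,
    add_comm 1 (1 - b), ← rlInt_rlInt hb' one_pos (by linarith) hu i₁,
    rlInt_congr (φ := rlInt 1 (halfLineDeriv 1 y₁)) (ψ := rlInt b (halfLineDeriv 1 y₀)) hu.le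
      fun τ hτ => by rw [e₁ τ hτ, h₁.eq_add_rlInt hτ.le, hzero, zero_add],
    rlInt_rlInt hb' hb0 (by linarith) hu i₀, sub_add_cancel]

/-! ### Caputo derivatives -/

theorem caputoDeriv_of_lt {α : ℝ} {n : ℕ} (h₁ : (n : ℝ) < α) (h₂ : α < n + 1) (f : ℝ → ℝ) :
    caputoDeriv α f = rlInt ((n + 1 : ℕ) - α) (halfLineDeriv (n + 1) f) := by
  have hc : ⌈α⌉₊ = n + 1 := by
    rw [Nat.ceil_eq_iff (by omega)]
    exact ⟨by simpa using h₁, by push_cast; exact h₂.le⟩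
  have hne : ¬ α = ((n + 1 : ℕ) : ℝ) := by push_cast; exact h₂.ne
  ext t
  rw [caputoDeriv, hc, if_neg hne, rlInt]
  simp only [caputoIntegrand, hc]

theorem caputoExistsAt_of_lt {α : ℝ} {n : ℕ} (h₁ : (n : ℝ) < α) (h₂ : α < n + 1) (f : ℝ → ℝ)
    (t : ℝ) : CaputoExistsAt α f t ↔ IntervalIntegrable
      (fun τ => (t - τ) ^ (((n + 1 : ℕ) : ℝ) - α - 1) * halfLineDeriv (n + 1) f τ) volume 0 t := by
  have hc : ⌈α⌉₊ = n + 1 := by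
    rw [Nat.ceil_eq_iff (by omega)]
    exact ⟨by simpa using h₁, by push_cast; exact h₂.le⟩
  have hne : ¬ α = ((n + 1 : ℕ) : ℝ) := by push_cast; exact h₂.ne
  rw [CaputoExistsAt, hc, if_neg hne]
  unfold caputoIntegrand
  rw [hc]

/-- The Caputo derivative of order `α ∈ (n, n + 1]` of `f` is that of order `α - n ∈ (0, 1]` of
the `n`-th derivative of `f`. -/
theorem hasCaputoDerivAt_iff_sub {α : ℝ} {n : ℕ} (h₁ : (n : ℝ) < α) (h₂ : α ≤ n + 1)
    {f z : ℝ → ℝ} (hz : Set.EqOn (halfLineDeriv n f) z (Set.Ici 0)) {v t : ℝ} (ht : 0 < t) :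
    HasCaputoDerivAt α f v t ↔ HasCaputoDerivAt (α - n) z v t := by
  have hd : Set.EqOn (halfLineDeriv (n + 1) f) (halfLineDeriv 1 z) (Set.Ici 0) := by
    rw [halfLineDeriv_succ, halfLineDeriv_one]
    exact derivWithin_eqOn hz
  unfold HasCaputoDerivAt
  rcases h₂.eq_or_lt with rfl | h₂
  · have e : ((n : ℝ) + 1) - n = 1 := by ring
    have c : ⌈(n : ℝ) + 1⌉₊ = n + 1 := by exact_mod_cast Nat.ceil_natCast (R := ℝ) (n + 1)
    rw [e]
    simp only [CaputoExistsAt, caputoDeriv, c, Nat.ceil_one, Nat.cast_add, Nat.cast_one, if_true,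
      Nat.add_sub_cancel, Nat.sub_self, halfLineDeriv_zero, hd (Set.mem_Ici.2 ht.le)]
    refine and_congr_left fun _ => ⟨fun h => ?_, fun h => ?_⟩
    · exact h.congr (fun u hu => (hz hu).symm) (hz (Set.mem_Ici.2 ht.le)).symm
    · exact h.congr hz (hz (Set.mem_Ici.2 ht.le))
  · have k₁ : ((0 : ℕ) : ℝ) < α - n := by simpa using h₁
    have k₂ : α - n < ((0 : ℕ) : ℝ) + 1 := by push_cast; linarith
    have e : (((0 + 1 : ℕ) : ℝ) - (α - n)) = ((n + 1 : ℕ) : ℝ) - α := by push_cast; ring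
    rw [caputoDeriv_of_lt h₁ h₂, caputoDeriv_of_lt k₁ k₂, caputoExistsAt_of_lt h₁ h₂,
      caputoExistsAt_of_lt k₁ k₂, e, zero_add,
      rlInt_congr ht.le fun τ hτ => hd (Set.mem_Ici.2 (le_of_lt hτ))]
    refine and_congr_left fun _ => intervalIntegrable_congr fun τ hτ => ?_
    rw [uIoc_of_le ht.le] at hτ
    simp only [hd (Set.mem_Ici.2 hτ.1.le)]

theorem IsAC.isAC_halfLineDeriv {m : ℕ} {x : ℝ → ℝ} (hx : IsAC m x) {j : ℕ} (hj : j < m) :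
    IsAC 1 (halfLineDeriv j x) := by
  rcases (Nat.le_sub_one_of_lt hj).eq_or_lt with rfl | hlt
  · exact isAC_one_iff.2 hx.2
  · refine isAC_one_of_contDiffOn ?_
    have hu : UniqueDiffOn ℝ (Set.Ici (0 : ℝ)) := uniqueDiffOn_Ici 0
    have key : ∀ (n : ℕ) (f : ℝ → ℝ), ContDiffOn ℝ ((n + 1 : ℕ) : WithTop ℕ∞) f (Set.Ici 0) →
        ContDiffOn ℝ (n : WithTop ℕ∞) (derivWithin f (Set.Ici 0)) (Set.Ici 0) := fun n f hf =>
      hf.derivWithin hu (by push_cast; exact le_rfl)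
    have hall : ∀ i n : ℕ, i + n = m - 1 →
        ContDiffOn ℝ (n : WithTop ℕ∞) (halfLineDeriv i x) (Set.Ici 0) := by
      intro i
      induction i with
      | zero =>
        intro n hn
        rw [halfLineDeriv_zero]
        have := hx.1
        rwa [← hn, zero_add] at this
      | succ i ih =>
        intro n hn
        rw [halfLineDeriv_succ]
        exact key n _ (ih (n + 1) (by omega))
    exact (hall j (m - 1 - j) (by omega)).of_le (by exact_mod_cast (by omega : 1 ≤ m - 1 - j))

/-! ### The split family -/

theorem splitOrder_even (α : ℕ → ℝ) (j : ℕ) : splitOrder α (2 * j) = α (j + 1) - j := by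
  simp [splitOrder]

theorem splitOrder_odd (α : ℕ → ℝ) (j : ℕ) :
    splitOrder α (2 * j + 1) = ((j + 1 : ℕ) : ℝ) - α (j + 1) := by
  have h1 : (2 * j + 1) % 2 = 1 := by omega
  have h2 : (2 * j + 1) / 2 = j := by omega
  simp [splitOrder, h1, h2]

/-- The family `y` built from `x`: the even members are the derivatives of `x`, the odd ones its
Caputo derivatives. For a non-integer order the value of the latter at `0` is that of an
integral from `0` to `0`, and so the initial condition `y_{2i-1}(0) = 0` holds. -/
noncomputable def splitFamily (α : ℕ → ℝ) (x : ℝ → ℝ) (k : ℕ) : ℝ → ℝ :=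
  if k % 2 = 0 then halfLineDeriv (k / 2) x else caputoDeriv (α (k / 2 + 1)) x

theorem splitFamily_even (α : ℕ → ℝ) (x : ℝ → ℝ) (j : ℕ) :
    splitFamily α x (2 * j) = halfLineDeriv j x := by
  simp [splitFamily]

theorem splitFamily_odd (α : ℕ → ℝ) (x : ℝ → ℝ) (j : ℕ) :
    splitFamily α x (2 * j + 1) = caputoDeriv (α (j + 1)) x := by
  have h1 : (2 * j + 1) % 2 = 1 := by omega
  have h2 : (2 * j + 1) / 2 = j := by omega
  simp [splitFamily, h1, h2]

theorem equation_iff {m : ℕ} (hm : 1 ≤ m) {a : ℕ → ℝ} (ham : a m ≠ 0) (X : ℝ) (D : ℕ → ℝ) :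
    a 0 * X + ∑ k ∈ Finset.Icc 1 m, a k * D k = 0 ↔
      D m = -1 / a m * (a 0 * X + ∑ k ∈ Finset.Icc 1 (m - 1), a k * D k) := by
  obtain ⟨n, rfl⟩ : ∃ n, m = n + 1 := ⟨m - 1, by omega⟩
  rw [Finset.sum_Icc_succ_top (by omega), Nat.add_sub_cancel]
  constructor
  · intro h
    field_simp
    linarith
  · intro h
    rw [h]
    field_simp
    ring

/-! ### The equivalence -/

theorem HasCaputoDerivAt.rlInt_eq {β : ℝ} (h0 : 0 < β) (h1 : β < 1) {f : ℝ → ℝ} {v t : ℝ}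
    (h : HasCaputoDerivAt β f v t) : rlInt (1 - β) (halfLineDeriv 1 f) t = v := by
  have := h.2
  rwa [caputoDeriv_of_lt (n := 0) (by simpa using h0) (by simpa using h1), zero_add,
    Nat.cast_one] at this

/-- Only the last order may be an integer: each of the others is complemented by an odd member of
the splitting, which is positive. -/
theorem lt_of_splitOrder_pos {m : ℕ} {α : ℕ → ℝ}
    (hβ : ∀ k : ℕ, k ≤ 2 * m - 2 → 0 < splitOrder α k ∧ splitOrder α k ≤ 1) {j : ℕ}
    (hj : j + 1 < m) : (j : ℝ) < α (j + 1) ∧ α (j + 1) < j + 1 := by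
  have h0 := (hβ (2 * j) (by omega)).1
  have h1 := (hβ (2 * j + 1) (by omega)).1
  rw [splitOrder_even] at h0
  rw [splitOrder_odd] at h1
  push_cast at h1
  exact ⟨by linarith, by linarith⟩

theorem sum_odd_eq (m : ℕ) (a : ℕ → ℝ) (y D : ℕ → ℝ)
    (h : ∀ j, j + 1 < m → y (2 * j + 1) = D (j + 1)) :
    ∑ k ∈ Finset.Icc 1 (m - 1), a k * y (2 * k - 1) = ∑ k ∈ Finset.Icc 1 (m - 1), a k * D k := by
  refine Finset.sum_congr rfl fun k hk => ?_
  obtain ⟨h1, h2⟩ := Finset.mem_Icc.1 hk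
  obtain ⟨j, rfl⟩ : ∃ j, k = j + 1 := ⟨k - 1, by omega⟩
  rw [show 2 * (j + 1) - 1 = 2 * j + 1 by omega, h j (by omega)]

theorem IsMultiTermSolution.isSystemSolution {m : ℕ} (hm : 1 ≤ m) {a α C : ℕ → ℝ} (ham : a m ≠ 0)
    (hα : ∀ k : ℕ, 1 ≤ k → k ≤ m → (k : ℝ) - 1 < α k ∧ α k ≤ (k : ℝ))
    (hβ : ∀ k : ℕ, k ≤ 2 * m - 2 → 0 < splitOrder α k ∧ splitOrder α k ≤ 1)
    {x : ℝ → ℝ} (hx : IsMultiTermSolution m a α C x) :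
    IsSystemSolution m a (splitOrder α) C x (splitFamily α x) := by
  have hodd : ∀ j, j + 1 < m → splitFamily α x (2 * j + 1)
      = rlInt (((j + 1 : ℕ) : ℝ) - α (j + 1)) (halfLineDeriv (j + 1) x) := fun j hj => by
    rw [splitFamily_odd, caputoDeriv_of_lt (lt_of_splitOrder_pos hβ hj).1
      (lt_of_splitOrder_pos hβ hj).2]
  have hstep : ∀ j, j + 1 < m → _ := fun j hj =>
    isAC_rlInt (b := ((j + 1 : ℕ) : ℝ) - α (j + 1))
      (by push_cast; linarith [(lt_of_splitOrder_pos hβ hj).2])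
      (by push_cast; linarith [(lt_of_splitOrder_pos hβ hj).1]) (hx.regular.isAC_halfLineDeriv hj)
  have heven : ∀ j, j < m → ∀ t, 0 < t → HasCaputoDerivAt (splitOrder α (2 * j))
      (splitFamily α x (2 * j)) (caputoDeriv (α (j + 1)) x t) t := fun j hj t ht => by
    have h := hα (j + 1) (by omega) (by omega)
    push_cast at h
    rw [splitOrder_even, splitFamily_even,
      ← hasCaputoDerivAt_iff_sub (by linarith) h.2 (fun _ _ => rfl) ht]
    exact ⟨hx.exists_caputo (j + 1) (by omega) (by omega) t ht, rfl⟩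
  refine ⟨fun k hk => ?_, fun t _ => ?_, fun k hk t ht => ?_, fun t ht => ?_, fun i h1 h2 => ?_,
    fun i hi => ?_⟩
  · rcases Nat.even_or_odd' k with ⟨j, rfl | rfl⟩
    · rw [splitFamily_even]
      exact hx.regular.isAC_halfLineDeriv (by omega)
    · rw [hodd j (by omega)]
      exact (hstep j (by omega)).1
  · rw [show (0 : ℕ) = 2 * 0 by rfl, splitFamily_even, halfLineDeriv_zero]
  · rcases Nat.even_or_odd' k with ⟨j, rfl | rfl⟩
    · rw [splitFamily_odd]
      exact heven j (by omega) t ht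
    · have hj : j + 1 < m := by omega
      obtain ⟨l1, l2⟩ := lt_of_splitOrder_pos hβ hj
      rw [splitOrder_odd, show 2 * j + 1 + 1 = 2 * (j + 1) by ring, splitFamily_even, hodd j hj]
      have q₁ : ((0 : ℕ) : ℝ) < ((j + 1 : ℕ) : ℝ) - α (j + 1) := by push_cast; linarith
      have q₂ : ((j + 1 : ℕ) : ℝ) - α (j + 1) < ((0 : ℕ) : ℝ) + 1 := by push_cast; linarith
      unfold HasCaputoDerivAt
      rw [caputoExistsAt_of_lt q₁ q₂, caputoDeriv_of_lt q₁ q₂, zero_add, Nat.cast_one]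
      exact (hstep j hj).2 t ht
  · have h := heven (m - 1) (by omega) t ht
    rw [show 2 * (m - 1) = 2 * m - 2 by omega, show m - 1 + 1 = m by omega] at h
    rw [sum_odd_eq m a (fun k => splitFamily α x k t) (fun k => caputoDeriv (α k) x t)
      fun j _ => by simp only [splitFamily_odd],
      ← (equation_iff hm ham (x t) fun k => caputoDeriv (α k) x t).1 (hx.equation t ht)]
    exact h
  · obtain ⟨j, rfl⟩ : ∃ j, i = j + 1 := ⟨i - 1, by omega⟩
    rw [show 2 * (j + 1) - 1 = 2 * j + 1 by omega, hodd j h2, rlInt_zero]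
  · rw [splitFamily_even]
    exact hx.initial i hi

theorem IsSystemSolution.hasDerivWithinAt {m : ℕ} {a α C : ℕ → ℝ}
    (hβ : ∀ k : ℕ, k ≤ 2 * m - 2 → 0 < splitOrder α k ∧ splitOrder α k ≤ 1)
    {x : ℝ → ℝ} {y : ℕ → ℝ → ℝ} (hy : IsSystemSolution m a (splitOrder α) C x y) {j : ℕ}
    (hj : j + 1 < m) {t : ℝ} (ht : 0 ≤ t) :
    HasDerivWithinAt (y (2 * j)) (y (2 * (j + 1)) t) (Set.Ici 0) t := by
  obtain ⟨l1, l2⟩ := lt_of_splitOrder_pos hβ hj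
  refine hasDerivWithinAt_of_chain (b := ((j + 1 : ℕ) : ℝ) - α (j + 1)) (y₁ := y (2 * j + 1))
    (by push_cast; linarith) (by push_cast; linarith) (hy.regular _ (by omega))
    (hy.regular _ (by omega)) (hy.regular _ (by omega)) ?_ (fun u hu => ?_) (fun u hu => ?_) ht
  · have := hy.initial_odd (j + 1) (by omega) hj
    rwa [show 2 * (j + 1) - 1 = 2 * j + 1 by omega] at this
  · have h := hy.chain (2 * j) (by omega) u hu
    rw [splitOrder_even] at h
    rw [← h.rlInt_eq (by linarith) (by linarith)]
    congr 1
    push_cast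
    ring
  · have h := hy.chain (2 * j + 1) (by omega) u hu
    rw [splitOrder_odd] at h
    exact h.rlInt_eq (by push_cast; linarith) (by push_cast; linarith)

theorem IsSystemSolution.halfLineDeriv_eq {m : ℕ} {a α C : ℕ → ℝ}
    (hβ : ∀ k : ℕ, k ≤ 2 * m - 2 → 0 < splitOrder α k ∧ splitOrder α k ≤ 1)
    {x : ℝ → ℝ} {y : ℕ → ℝ → ℝ} (hy : IsSystemSolution m a (splitOrder α) C x y) {j : ℕ}
    (hj : j < m) : Set.EqOn (halfLineDeriv j x) (y (2 * j)) (Set.Ici 0) := by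
  induction j with
  | zero =>
    intro t ht
    rw [halfLineDeriv_zero]
    exact hy.first t ht
  | succ j ih =>
    intro t ht
    rw [halfLineDeriv_succ, derivWithin_eqOn (ih (by omega)) ht]
    exact (hy.hasDerivWithinAt hβ hj ht).derivWithin (uniqueDiffOn_Ici 0 t ht)

theorem IsSystemSolution.contDiffOn {m : ℕ} {a α C : ℕ → ℝ}
    (hβ : ∀ k : ℕ, k ≤ 2 * m - 2 → 0 < splitOrder α k ∧ splitOrder α k ≤ 1)
    {x : ℝ → ℝ} {y : ℕ → ℝ → ℝ} (hy : IsSystemSolution m a (splitOrder α) C x y) (n : ℕ) :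
    ∀ {j : ℕ}, j + n < m → ContDiffOn ℝ (n : WithTop ℕ∞) (y (2 * j)) (Set.Ici 0) := by
  induction n with
  | zero =>
    intro j hj
    rw [Nat.cast_zero, contDiffOn_zero]
    exact (hy.regular _ (by omega)).continuousOn_one
  | succ n ih =>
    intro j hj
    have hu : UniqueDiffOn ℝ (Set.Ici (0 : ℝ)) := uniqueDiffOn_Ici 0
    push_cast
    rw [contDiffOn_succ_iff_derivWithin hu]
    refine ⟨fun t ht => (hy.hasDerivWithinAt hβ (by omega) ht).differentiableWithinAt, ?_, ?_⟩
    · intro h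
      exact absurd h (by exact_mod_cast WithTop.coe_ne_top)
    · exact (ih (j := j + 1) (by omega)).congr fun t ht =>
        (hy.hasDerivWithinAt hβ (by omega) ht).derivWithin (hu t ht)

theorem IsSystemSolution.isMultiTermSolution {m : ℕ} (hm : 1 ≤ m) {a α C : ℕ → ℝ} (ham : a m ≠ 0)
    (hα : ∀ k : ℕ, 1 ≤ k → k ≤ m → (k : ℝ) - 1 < α k ∧ α k ≤ (k : ℝ))
    (hβ : ∀ k : ℕ, k ≤ 2 * m - 2 → 0 < splitOrder α k ∧ splitOrder α k ≤ 1)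
    {x : ℝ → ℝ} {y : ℕ → ℝ → ℝ} (hy : IsSystemSolution m a (splitOrder α) C x y) :
    IsMultiTermSolution m a α C x := by
  have hcap : ∀ {j : ℕ}, j < m → ∀ {v t : ℝ}, 0 < t →
      (HasCaputoDerivAt (α (j + 1)) x v t ↔
        HasCaputoDerivAt (splitOrder α (2 * j)) (y (2 * j)) v t) := fun {j} hj v t ht => by
    have h := hα (j + 1) (by omega) (by omega)
    push_cast at h
    rw [splitOrder_even]
    exact hasCaputoDerivAt_iff_sub (by linarith) h.2 (hy.halfLineDeriv_eq hβ hj) ht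
  have hodd : ∀ j, j + 1 < m → ∀ t, 0 < t → HasCaputoDerivAt (α (j + 1)) x (y (2 * j + 1) t) t :=
    fun j hj t ht => (hcap (by omega) ht).2 (hy.chain (2 * j) (by omega) t ht)
  have hlast : ∀ t, 0 < t → HasCaputoDerivAt (α m) x
      (-1 / a m * (a 0 * x t + ∑ k ∈ Finset.Icc 1 (m - 1), a k * y (2 * k - 1) t)) t :=
    fun t ht => by
      have h := hcap (j := m - 1) (by omega) (v := -1 / a m *
        (a 0 * x t + ∑ k ∈ Finset.Icc 1 (m - 1), a k * y (2 * k - 1) t)) ht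
      rw [show 2 * (m - 1) = 2 * m - 2 by omega, show m - 1 + 1 = m by omega] at h
      exact h.2 (hy.last t ht)
  refine ⟨⟨?_, ?_⟩, fun k h1 h2 t ht => ?_, fun t ht => ?_, fun i hi => ?_⟩
  · exact (hy.contDiffOn hβ (m - 1) (j := 0) (by omega)).congr fun t ht => hy.first t ht
  · exact isAC_one_iff.1 ((hy.regular (2 * (m - 1)) (by omega)).congr_one
      (hy.halfLineDeriv_eq hβ (by omega)).symm)
  · rcases h2.eq_or_lt with rfl | h2
    · exact (hlast t ht).1
    · obtain ⟨j, rfl⟩ : ∃ j, k = j + 1 := ⟨k - 1, by omega⟩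
      exact (hodd j h2 t ht).1
  · rw [equation_iff hm ham (x t) fun k => caputoDeriv (α k) x t, (hlast t ht).2,
      sum_odd_eq m a (fun k => y k t) (fun k => caputoDeriv (α k) x t)
        fun j hj => ((hodd j hj t ht).2).symm]
  · rw [hy.halfLineDeriv_eq hβ hi (Set.mem_Ici.2 le_rfl)]
    exact hy.initial_even i hi

end CaputoSplit

theorem mainTheorem1 (m : ℕ) (hm : 1 ≤ m) (a α C : ℕ → ℝ) (ham : a m ≠ 0)
    (hα : ∀ k : ℕ, 1 ≤ k → k ≤ m → (k : ℝ) - 1 < α k ∧ α k ≤ (k : ℝ))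
    (hβ : ∀ k : ℕ, k ≤ 2 * m - 2 →
      0 < CaputoSplit.splitOrder α k ∧ CaputoSplit.splitOrder α k ≤ 1)
    (x : ℝ → ℝ) :
    CaputoSplit.IsMultiTermSolution m a α C x ↔
      ∃ y : ℕ → ℝ → ℝ,
        CaputoSplit.IsSystemSolution m a (CaputoSplit.splitOrder α) C x y :=
  ⟨fun hx => ⟨CaputoSplit.splitFamily α x, hx.isSystemSolution hm ham hα hβ⟩,
    fun ⟨_, hy⟩ => hy.isMultiTermSolution hm ham hα hβ⟩
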